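/- Let $n,t\ge 0$, $\mathbf x=(x_1,\dots,x_n)$, $\mathbf y=(y_1,\dots,y_t)$, and let $\succ_{\mathbf x}$, $\succ_{\mathbf y}$ be arbitrary monomial orders on the monomials in $\mathbf x$ and in $\mathbf y$. Let $\succ$ be the block order eliminating $\mathbf x$ built from them: $\mathbf x^{a}\mathbf y^{b}\succ \mathbf x^{a'}\mathbf y^{b'}$ if $\mathbf x^a\succ_{\mathbf x}\mathbf x^{a'}$, or $a=a'$ and $\mathbf y^b\succ_{\mathbf y}\mathbf y^{b'}$. For a field $K$ of characteristic $0$, a finite system $\mathbf h\subset K[\mathbf x]$ generating a zero-dimensional ideal (the unit ideal is allowed), and $g\in K[\mathbf x]$, Hermite's bilinear form on the finite-dimensional $K$-algebra $A=K[\mathbf x]/\langle\mathbf h\rangle_K$ is $\mathrm{herm}(\mathbf h,g)(p,q)=\mathrm{Tr}(L_{gpq})$, where $L_u:A\to A$ is multiplication by $u$; Hermite's quadratic form is $\mathrm{Herm}(\mathbf h,g)(p)=\mathrm{herm}(\mathbf h,g)(p,p)$; and the Hermite matrix of $g$ in a basis $(b_i)$ of $A$ is $(\mathrm{herm}(\mathbf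 h,g)(b_i,b_j))_{i,j}$. Let $\mathbf f=(f_1,\dots,f_r)$ be a finite system in $\mathbb Q[\mathbf y][\mathbf x]$ such that the ideal $\langle\mathbf f\rangle_{\mathbb Q(\mathbf y)}$ of $\mathbb Q(\mathbf y)[\mathbf x]$ is zero-dimensional (the unit ideal is allowed). Let $\mathcal G$ be the reduced Gröbner basis, with respect to $\succ$, of the ideal $\langle\mathbf f\rangle$ of $\mathbb Q[\mathbf x,\mathbf y]$. For $\gamma\in\mathcal G$, let $\mathrm{lc}_{\mathbf x}(\gamma)\in\mathbb Q[\mathbf y]$ and $\mathrm{lm}_{\mathbf x}(\gamma)$ be the leading coefficient and leading monomial of $\gamma$, seen as a polynomial in $\mathbf x$ with coefficients in $\mathbb Q[\mathbf y]$, with respect to $\succ_{\mathbf x}$. Let $\mathcal B$ be the set of monomials in $\mathbf x$ divisible by no $\mathrm{lm}_{\mathbf x}(\gamma)$, $\gamma\in\mathcal G$, and let $$\mathcal W_\infty=\bigcup_{\gamma\in\mathcal G}\{y\in\mathbb C^t : \mathrm{lc}_{\mathbf x}(\gamma)(y)=0\}.$$ **Theorem.** For every $y\in\mathbb C^t\setminus\mathcal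 W_\infty$: 1. The specialization $\mathcal G(y,\cdot)$ is a Gröbner basis of the ideal $\langle\mathbf f(y,\cdot)\rangle\subset\mathbb C[\mathbf x]$ with respect to $\succ_{\mathbf x}$. 2. The set $\mathcal B$ is finite, and its elements form a $\mathbb Q(\mathbf y)$-basis of $\mathbb Q(\mathbf y)[\mathbf x]/\langle\mathbf f\rangle_{\mathbb Q(\mathbf y)}$ and a $\mathbb C$-basis of $\mathbb C[\mathbf x]/\langle\mathbf f(y,\cdot)\rangle$. For every $g\in\mathbb Q(\mathbf y)[\mathbf x]$ whose coefficients are defined at $y$ (in particular every $g\in\mathbb Q[\mathbf y][\mathbf x]$), $\mathrm{Herm}(\mathbf f,g)(y)=\mathrm{Herm}(\mathbf f(y,\cdot),g(y,\cdot))$. That is, the entries of the Hermite matrix of $g$ for $\langle\mathbf f\rangle_{\mathbb Q(\mathbf y)}$ in the basis $\mathcal B$ are rational functions defined at $y$, and their values at $y$ are the entries of the Hermite matrix of $g(y,\cdot)$ for $\langle\mathbf f(y,\cdot)\rangle$ in the basis $\mathcal B$. Moreover, for every $q\in\mathbb Q(\mathbf y)[\mathbf x]$ whose coefficients are defined at $y$,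 the rational function $\mathrm{Herm}(\mathbf f,g)(q)$ is defined at $y$ and has the value $\mathrm{Herm}(\mathbf f(y,\cdot),g(y,\cdot))(q(y,\cdot))$ there. -/

import Mathlib

open MvPolynomial
open scoped MonomialOrder

noncomputable section

namespace HermiteSpec

/-! ### Monomial orders and Gröbner bases -/

/-- The block (product) order on monomials in `x` and `y` which eliminates `x`: the `x`-parts are
compared first with `mx`, and ties are broken by comparing the `y`-parts with `my`. -/
def blockOrder {σ τ : Type*} (mx : MonomialOrder σ) (my : MonomialOrder τ) :
    MonomialOrder (σ ⊕ τ) where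
  syn := mx.syn ×ₗ my.syn
  toSyn :=
    { toFun := fun a => toLex
        (mx.toSyn (Finsupp.sumFinsuppAddEquivProdFinsupp a).1,
          my.toSyn (Finsupp.sumFinsuppAddEquivProdFinsupp a).2)
      invFun := fun s => Finsupp.sumFinsuppAddEquivProdFinsupp.symm
        (mx.toSyn.symm (ofLex s).1, my.toSyn.symm (ofLex s).2)
      left_inv := fun a => by simp
      right_inv := fun s => by simp
      map_add' := fun a b => by simp only [map_add, Prod.fst_add, Prod.snd_add]; rfl }
  toSyn_monotone := by
    intro a b hab
    apply Prod.Lex.toLex_mono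
    refine ⟨mx.toSyn_monotone fun i => ?_, my.toSyn_monotone fun j => ?_⟩
    · exact hab (Sum.inl i)
    · exact hab (Sum.inr j)

/-- Strict comparison in the block order. -/
theorem blockOrder_lt_iff {σ τ : Type*} (mx : MonomialOrder σ) (my : MonomialOrder τ)
    (a b : σ ⊕ τ →₀ ℕ) :
    a ≺[blockOrder mx my] b ↔
      (Finsupp.sumFinsuppEquivProdFinsupp a).1 ≺[mx] (Finsupp.sumFinsuppEquivProdFinsupp b).1 ∨
      (Finsupp.sumFinsuppEquivProdFinsupp a).1 = (Finsupp.sumFinsuppEquivProdFinsupp b).1 ∧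
      (Finsupp.sumFinsuppEquivProdFinsupp a).2 ≺[my]
        (Finsupp.sumFinsuppEquivProdFinsupp b).2 := by
  refine (Prod.Lex.lt_iff (α := mx.syn) (β := my.syn)).trans (or_congr Iff.rfl (and_congr ?_ Iff.rfl))
  exact mx.toSyn.injective.eq_iff

/-- `G` is a (finite) Gröbner basis of the ideal `I` for the monomial order `m`: it is contained
in `I` and the leading terms of `G` generate the ideal of leading terms of `I`. -/
structure IsGroebnerBasis {σ k : Type*} [Field k] (m : MonomialOrder σ)
    (I : Ideal (MvPolynomial σ k)) (G : Set (MvPolynomial σ k)) : Prop where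
  finite : G.Finite
  subset : G ⊆ I
  span_leadingTerm :
    Ideal.span (m.leadingTerm '' G) = Ideal.span (m.leadingTerm '' (I : Set (MvPolynomial σ k)))

/-- `G` is the reduced Gröbner basis of `I` for `m`: all its elements are monic, and no monomial
of an element `γ` lies in the ideal generated by the leading terms of the other elements. -/
structure IsReducedGroebnerBasis {σ k : Type*} [Field k] (m : MonomialOrder σ)
    (I : Ideal (MvPolynomial σ k)) (G : Set (MvPolynomial σ k)) : Prop
    extends IsGroebnerBasis m I G where
  monic : ∀ γ ∈ G, m.Monic γ
  reduced : ∀ γ ∈ G, ∀ a ∈ γ.support,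
    (monomial a 1 : MvPolynomial σ k) ∉ Ideal.span (m.leadingTerm '' (G \ {γ}))

/-! ### Hermite's forms -/

/-- The algebra `k[x]/⟨f⟩`. -/
abbrev QuotAlg {σ ι k : Type*} [Field k] (f : ι → MvPolynomial σ k) : Type _ :=
  MvPolynomial σ k ⧸ Ideal.span (Set.range f)

/-- The class of a polynomial in `k[x]/⟨f⟩`. -/
abbrev cls {σ ι k : Type*} [Field k] (f : ι → MvPolynomial σ k) (q : MvPolynomial σ k) :
    QuotAlg f :=
  Ideal.Quotient.mk (Ideal.span (Set.range f)) q

/-- The system `f` generates a zero-dimensional ideal of `k[x]` (the unit ideal is allowed). -/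
def IsZeroDimensional {σ ι k : Type*} [Field k] (f : ι → MvPolynomial σ k) : Prop :=
  ringKrullDim (QuotAlg f) ≤ 0

/-- The bilinear form `(p, q) ↦ Tr (h ↦ g p q h)` on a commutative `k`-algebra `A`. -/
def twistedTraceForm (k : Type*) {A : Type*} [Field k] [CommRing A] [Algebra k A] (g : A) :
    LinearMap.BilinForm k A :=
  LinearMap.mk₂ k
    (fun p q => LinearMap.trace k A (LinearMap.mulLeft k (g * p * q)))
    (fun p p' q => by
      rw [← map_add]; congr 1; ext; simp [mul_add, add_mul, mul_assoc])
    (fun c p q => by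
      rw [← map_smul]; congr 1; ext; simp [mul_assoc])
    (fun p q q' => by
      rw [← map_add]; congr 1; ext; simp [mul_add, add_mul, mul_assoc])
    (fun c p q => by
      rw [← map_smul]; congr 1; ext; simp [mul_assoc])

/-- Hermite's bilinear form `(p, q) ↦ Tr (h ↦ g p q h)` on `k[x]/⟨f⟩`. -/
def hermiteBilin {σ ι k : Type*} [Field k] (f : ι → MvPolynomial σ k) (g : MvPolynomial σ k) :
    LinearMap.BilinForm k (QuotAlg f) :=
  twistedTraceForm k (cls f g)

/-- Hermite's quadratic form `p ↦ Tr (h ↦ g p² h)` on `k[x]/⟨f⟩`. -/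
def hermiteForm {σ ι k : Type*} [Field k] (f : ι → MvPolynomial σ k) (g : MvPolynomial σ k) :
    QuadraticForm k (QuotAlg f) :=
  LinearMap.BilinMap.toQuadraticMap (hermiteBilin f g)

/-- The Hermite matrix of `g` with respect to a basis `b` of `k[x]/⟨f⟩`. -/
def hermiteMatrix {σ ι κ k : Type*} [Field k] (f : ι → MvPolynomial σ k) (g : MvPolynomial σ k)
    (b : Module.Basis κ k (QuotAlg f)) : Matrix κ κ k :=
  Matrix.of fun i j => hermiteBilin f g (b i) (b j)

/-! ### Parameters: `x = (x₁, …, xₙ)`, `y = (y₁, …, yₜ)` -/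

/-- The polynomial ring `ℚ[x, y]`. -/
abbrev XY (n t : ℕ) : Type := MvPolynomial (Fin n ⊕ Fin t) ℚ

/-- The field of rational functions `ℚ(y)`. -/
abbrev RatFun (t : ℕ) : Type := FractionRing (MvPolynomial (Fin t) ℚ)

/-- A polynomial of `ℚ[x, y]` seen in `ℚ[y][x]`. -/
def inX {n t : ℕ} (q : XY n t) : MvPolynomial (Fin n) (MvPolynomial (Fin t) ℚ) :=
  sumAlgEquiv ℚ (Fin n) (Fin t) q

/-- A polynomial of `ℚ[x, y]` seen in `ℚ(y)[x]`. -/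
def generic {n t : ℕ} (q : XY n t) : MvPolynomial (Fin n) (RatFun t) :=
  MvPolynomial.map (algebraMap (MvPolynomial (Fin t) ℚ) (RatFun t)) (inX q)

/-- The specialization `q(y, ·) ∈ ℂ[x]` at a point `y ∈ ℂᵗ`. -/
def specialize {n t : ℕ} (y : Fin t → ℂ) (q : XY n t) : MvPolynomial (Fin n) ℂ :=
  MvPolynomial.map (aeval y : MvPolynomial (Fin t) ℚ →ₐ[ℚ] ℂ).toRingHom (inX q)

/-- The leading coefficient `lc_x(q) ∈ ℚ[y]` of `q`, seen as a polynomial in `x`. -/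
def lcX {n t : ℕ} (mx : MonomialOrder (Fin n)) (q : XY n t) : MvPolynomial (Fin t) ℚ :=
  mx.leadingCoeff (inX q)

/-- The union of the zero loci in `ℂᵗ` of the leading coefficients `lc_x(γ)`, `γ ∈ G`. -/
def badLocus {n t : ℕ} (mx : MonomialOrder (Fin n)) (G : Set (XY n t)) : Set (Fin t → ℂ) :=
  ⋃ γ ∈ G, {y | aeval y (lcX mx γ) = 0}

/-- The exponents of the monomials in `x` irreducible by `G`, that is, divisible by the leading
monomial in `x` of no element of `G`. -/
def irreducibleExponents {n t : ℕ} (mx : MonomialOrder (Fin n)) (G : Set (XY n t)) :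
    Set (Fin n →₀ ℕ) :=
  {a | ∀ γ ∈ G, ¬ mx.degree (inX γ) ≤ a}

/-- The rational function `h ∈ ℚ(y)` is defined at the point `y ∈ ℂᵗ` and has the value `v`
there. -/
def HasValueAt {t : ℕ} (y : Fin t → ℂ) (h : RatFun t) (v : ℂ) : Prop :=
  ∃ a b : MvPolynomial (Fin t) ℚ, aeval y b ≠ 0 ∧
    h = algebraMap _ (RatFun t) a / algebraMap _ (RatFun t) b ∧ v = aeval y a / aeval y b

/-- The value of a rational function at a point is unique. -/
theorem HasValueAt.unique {t : ℕ} {y : Fin t → ℂ} {h : RatFun t} {v w : ℂ}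
    (hv : HasValueAt y h v) (hw : HasValueAt y h w) : v = w := by
  obtain ⟨a, b, hb, h1, rfl⟩ := hv
  obtain ⟨c, d, hd, h2, rfl⟩ := hw
  have hb0 : algebraMap _ (RatFun t) b ≠ 0 := by
    rw [Ne, FaithfulSMul.algebraMap_eq_zero_iff]; rintro rfl; simp at hb
  have hd0 : algebraMap _ (RatFun t) d ≠ 0 := by
    rw [Ne, FaithfulSMul.algebraMap_eq_zero_iff]; rintro rfl; simp at hd
  rw [h1, div_eq_div_iff hb0 hd0, ← map_mul, ← map_mul] at h2
  have h3 := FaithfulSMul.algebraMap_injective (MvPolynomial (Fin t) ℚ) (RatFun t) h2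
  rw [div_eq_div_iff hb hd, ← map_mul, ← map_mul, h3]

/-- The coefficients of `q ∈ ℚ(y)[x]` are defined at `y ∈ ℂᵗ` and `Q = q(y, ·)`. -/
def HasSpecialization {n t : ℕ} (y : Fin t → ℂ) (q : MvPolynomial (Fin n) (RatFun t))
    (Q : MvPolynomial (Fin n) ℂ) : Prop :=
  ∀ a, HasValueAt y (q.coeff a) (Q.coeff a)

/-- Polynomials in `ℚ[x, y]` specialize everywhere. -/
theorem hasSpecialization_generic {n t : ℕ} (y : Fin t → ℂ) (q : XY n t) :
    HasSpecialization y (generic q) (specialize y q) := by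
  intro a
  refine ⟨(inX q).coeff a, 1, by simp, ?_, ?_⟩
  · simp [generic, coeff_map]
  · simp [specialize, coeff_map]

end HermiteSpec

end

namespace HermiteSpec

/-! ### Quotients by ideals with a normal form -/

section NormalForm

variable {σ : Type*} {m : MonomialOrder σ} {R : Type*} [CommRing R]

/-! Let S be the ring of rational functions defined at y, the localization of ℚ[y] at the
polynomials not vanishing there (`LocalFun y`). Outside the bad locus every lc_x(γ) is a unit of S,
so division by 𝒢 is possible in S[x] and the monomials of 𝓑 span S[x]/⟨f⟩. They are also independent
(`localX_eq_zero_of_support_subset`): a relation in S[x] becomes, after clearing denominators, an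
element q of ⟨f⟩ ⊂ ℚ[x, y] with the same support in x. Since the order eliminates x, some lm_x(γ)
divides lm_x(q), which contradicts irreducibility unless q = 0. So S[x]/⟨f⟩ is free over S with
basis 𝓑, and this persists along any ring map out of S, flat or not
(`eq_zero_of_mem_map_of_support_subset`). The inclusion S → ℚ(y) and the evaluation S → ℂ give the
two bases. Over ℂ, the absence of nonzero elements of the ideal supported on 𝓑 also gives the
Gröbner property. Traces in the basis 𝓑 are computed over S; the parametric and specialized Hermite
entries are the two images of one element of S. -/

/-- If every polynomial of `J` supported on the exponents irreducible by `G ⊆ J` vanishes, then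
the irreducible monomials are a basis of the quotient by `J`. -/
theorem exists_basis_of_isUnit_leadingCoeff {G : Set (MvPolynomial σ R)}
    (hG : ∀ γ ∈ G, IsUnit (m.leadingCoeff γ)) {J : Ideal (MvPolynomial σ R)} (hGJ : G ⊆ J)
    {B : Set (σ →₀ ℕ)} (hB : B = {a | ∀ γ ∈ G, ¬ m.degree γ ≤ a})
    (hJ : ∀ p ∈ J, ↑p.support ⊆ B → p = 0) :
    ∃ b : Module.Basis B R (MvPolynomial σ R ⧸ J),
      ∀ a, b a = Ideal.Quotient.mk J (monomial a.1 1) := by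
  let v : B → MvPolynomial σ R ⧸ J := fun a => Ideal.Quotient.mk J (monomial a.1 1)
  have hmk : ∀ (c : R) (p : MvPolynomial σ R),
      c • Ideal.Quotient.mk J p = Ideal.Quotient.mk J (c • p) := fun c p => rfl
  have hli : LinearIndependent R v := by
    rw [linearIndependent_iff]
    intro l hl
    let p : MvPolynomial σ R := l.sum fun a c => monomial a.1 c
    have hpc : ∀ a : B, p.coeff a.1 = l a := by
      classical
      intro a
      simp only [p, Finsupp.sum, coeff_sum, coeff_monomial]
      rw [Finset.sum_eq_single a]
      · simp
      · intro b _ hb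
        rw [if_neg (fun h => hb (Subtype.ext h))]
      · intro h
        simpa using h
    have hp : p ∈ J := by
      rw [← Ideal.Quotient.eq_zero_iff_mem, ← hl, Finsupp.linearCombination_apply]
      simp only [p, Finsupp.sum, map_sum, v, hmk, smul_monomial, smul_eq_mul, mul_one]
    have hs : ↑p.support ⊆ B := by
      classical
      intro a ha
      by_contra hab
      refine (mem_support_iff.1 ha) ?_
      simp only [p, Finsupp.sum, coeff_sum, coeff_monomial]
      refine Finset.sum_eq_zero fun b _ => if_neg ?_
      rintro rfl
      exact hab b.2
    ext a
    rw [← hpc, hJ p hp hs]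
    simp
  have hsp : ⊤ ≤ Submodule.span R (Set.range v) := by
    rintro x -
    obtain ⟨p, rfl⟩ := Ideal.Quotient.mk_surjective x
    -- Unit leading coefficients suffice for division over a ring; the remainder is supported on
    -- `B`.
    obtain ⟨g, r, h, -, hr⟩ := m.div_set hG p
    have hmem : Finsupp.linearCombination _ (fun b : G => (b : MvPolynomial σ R)) g ∈ J := by
      rw [Finsupp.linearCombination_apply]
      exact J.sum_mem fun b _ => J.smul_mem _ (hGJ b.2)
    have hpr : Ideal.Quotient.mk J p = Ideal.Quotient.mk J r := by
      rw [h, map_add, Ideal.Quotient.eq_zero_iff_mem.2 hmem, zero_add]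
    rw [hpr, r.as_sum, map_sum]
    refine Submodule.sum_mem _ fun a ha => ?_
    have : monomial a (r.coeff a) = r.coeff a • (monomial a 1 : MvPolynomial σ R) := by
      simp [smul_monomial]
    rw [this, ← hmk]
    exact Submodule.smul_mem _ _ (Submodule.subset_span ⟨⟨a, hB ▸ hr a ha⟩, rfl⟩)
  exact ⟨Module.Basis.mk hli hsp, fun a => Module.Basis.mk_apply hli hsp a⟩

/-- If no nonzero polynomial of `J` is supported on the exponents irreducible by `G ⊆ J`, then
the leading monomials of `J` are reducible by `G`. -/
theorem exists_degree_le_of_isUnit_leadingCoeff {G : Set (MvPolynomial σ R)}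
    (hG : ∀ γ ∈ G, IsUnit (m.leadingCoeff γ)) {J : Ideal (MvPolynomial σ R)} (hGJ : G ⊆ J)
    (hJ : ∀ p ∈ J, ↑p.support ⊆ {a | ∀ γ ∈ G, ¬ m.degree γ ≤ a} → p = 0)
    {p : MvPolynomial σ R} (hp : p ∈ J) (hp0 : p ≠ 0) :
    ∃ γ ∈ G, m.degree γ ≤ m.degree p := by
  obtain ⟨g, r, h, hdeg, hr⟩ := m.div_set hG p
  have hmem : Finsupp.linearCombination _ (fun b : G => (b : MvPolynomial σ R)) g ∈ J := by
    rw [Finsupp.linearCombination_apply]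
    exact J.sum_mem fun b _ => J.smul_mem _ (hGJ b.2)
  have hr0 : r = 0 := by
    refine hJ r ?_ hr
    rw [h] at hp
    exact (J.add_mem_iff_right hmem).1 hp
  rw [hr0, add_zero, Finsupp.linearCombination_apply, Finsupp.sum] at h
  have hc : p.coeff (m.degree p) ≠ 0 := m.coeff_degree_ne_zero_iff.2 hp0
  have hc' : p.coeff (m.degree p) = ∑ b ∈ g.support, (g b • b.1).coeff (m.degree p) := by
    conv_lhs => rw [h, coeff_sum]
    rw [← h]
  rw [hc'] at hc
  -- Some product must contribute to the leading monomial of `p`. As division keeps every product's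
  -- degree at most that of `p`, this one has exactly that degree.
  obtain ⟨b, -, hb⟩ := Finset.exists_ne_zero_of_sum_ne_zero hc
  rw [smul_eq_mul, mul_comm] at hb
  have hgb : g b ≠ 0 := by
    intro h0
    simp [h0] at hb
  have heq : m.degree p = m.degree (b.1 * g b) := by
    apply m.toSyn.injective
    exact le_antisymm (m.le_degree (mem_support_iff.2 hb)) (hdeg b)
  refine ⟨b.1, b.2, ?_⟩
  rw [heq, m.degree_mul_of_left_mem_nonZeroDivisors (hG _ b.2).mem_nonZeroDivisors hgb]
  exact le_self_add

end NormalForm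

/-! ### Change of the coefficient ring -/

section BaseChange

variable {σ : Type*} {S L : Type*} [CommRing S] [CommRing L] (φ : S →+* L)
  {J : Ideal (MvPolynomial σ S)} {B : Set (σ →₀ ℕ)}

/-- The coordinates of a polynomial over `S` modulo `J`, extended to polynomials over `L`. -/
noncomputable def normalFormMap (b : Module.Basis B S (MvPolynomial σ S ⧸ J)) :
    MvPolynomial σ L →ₗ[L] B →₀ L :=
  (basisMonomials σ L).constr L fun a =>
    (b.repr (Ideal.Quotient.mk J (monomial a 1))).mapRange φ φ.map_zero

theorem normalFormMap_monomial (b : Module.Basis B S (MvPolynomial σ S ⧸ J)) (a : σ →₀ ℕ) :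
    normalFormMap φ b (monomial a 1) =
      (b.repr (Ideal.Quotient.mk J (monomial a 1))).mapRange φ φ.map_zero := by
  have h : (monomial a 1 : MvPolynomial σ L) = basisMonomials σ L a := by
    rw [coe_basisMonomials]
  rw [normalFormMap, h, Module.Basis.constr_basis]

theorem normalFormMap_map (b : Module.Basis B S (MvPolynomial σ S ⧸ J)) (p : MvPolynomial σ S) :
    normalFormMap φ b (map φ p) =
      (b.repr (Ideal.Quotient.mk J p)).mapRange φ φ.map_zero := by
  induction p using MvPolynomial.induction_on' with
  | monomial a c =>
    have h1 : map φ (monomial a c) = φ c • (monomial a 1 : MvPolynomial σ L) := by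
      simp [smul_monomial]
    have h2 : Ideal.Quotient.mk J (monomial a c) =
        c • Ideal.Quotient.mk J (monomial a 1) := by
      have : monomial a c = c • (monomial a 1 : MvPolynomial σ S) := by simp [smul_monomial]
      rw [this]; rfl
    rw [h1, map_smul, normalFormMap_monomial, h2, map_smul]
    ext i
    simp
  | add p q hp hq =>
    rw [map_add, map_add, hp, hq, map_add, map_add]
    ext i
    simp

/-- The coordinate map factors through the quotient by the extended ideal; this is what transports
linear independence without flatness. -/
theorem normalFormMap_eq_zero (b : Module.Basis B S (MvPolynomial σ S ⧸ J))
    {p : MvPolynomial σ L} (hp : p ∈ J.map (map φ)) : normalFormMap φ b p = 0 := by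
  -- The map is only `L`-linear, so the induction over the ideal must carry all polynomial
  -- multiples.
  suffices h : ∀ r : MvPolynomial σ L, normalFormMap φ b (r * p) = 0 by simpa using h 1
  refine Submodule.span_induction (p := fun p _ => ∀ r, normalFormMap φ b (r * p) = 0)
    ?_ ?_ ?_ ?_ hp
  · rintro _ ⟨j, hj, rfl⟩ r
    induction r using MvPolynomial.induction_on' with
    | monomial a c =>
      have : monomial a c * map φ j = c • map φ (monomial a 1 * j) := by
        rw [map_mul, map_monomial, map_one, ← smul_mul_assoc, smul_monomial, smul_eq_mul, mul_one]
      rw [this, map_smul, normalFormMap_map,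
        Ideal.Quotient.eq_zero_iff_mem.2 (J.mul_mem_left _ hj)]
      simp
    | add p q hp hq => rw [add_mul, map_add, hp, hq, add_zero]
  · simp
  · intro p q _ _ hp hq r
    rw [mul_add, map_add, hp, hq, add_zero]
  · intro s p _ hp r
    rw [smul_eq_mul, ← mul_assoc, hp]

/-- A polynomial of the extended ideal which is supported on the basis monomials vanishes. -/
theorem eq_zero_of_mem_map_of_support_subset (b : Module.Basis B S (MvPolynomial σ S ⧸ J))
    (hb : ∀ a, b a = Ideal.Quotient.mk J (monomial a.1 1))
    {p : MvPolynomial σ L} (hp : p ∈ J.map (map φ)) (hs : ↑p.support ⊆ B) : p = 0 := by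
  have h0 := normalFormMap_eq_zero φ b hp
  -- A basis monomial is its own normal form, so on polynomials supported on `B` the map reads off
  -- coefficients.
  have key : ∀ i : B, normalFormMap φ b p i = p.coeff i.1 := by
    classical
    intro i
    have hm : ∀ a ∈ p.support, normalFormMap φ b (monomial a (p.coeff a)) i =
        if a = i.1 then p.coeff a else 0 := by
      intro a ha
      have h1 : monomial a (p.coeff a) = p.coeff a • (monomial a 1 : MvPolynomial σ L) := by
        simp [smul_monomial]
      rw [h1, map_smul, normalFormMap_monomial, ← hb ⟨a, hs ha⟩, b.repr_self]
      by_cases h : a = i.1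
      · subst h; simp
      · rw [if_neg h]
        have : (⟨a, hs ha⟩ : B) ≠ i := fun e => h (congrArg Subtype.val e)
        simp [Finsupp.single_eq_of_ne this.symm]
    conv_lhs => rw [p.as_sum, map_sum, Finsupp.finsetSum_apply, Finset.sum_congr rfl hm]
    rw [Finset.sum_ite_eq' p.support i.1, ite_eq_left_iff]
    intro h
    exact (notMem_support_iff.1 h).symm
  ext a
  by_cases ha : a ∈ p.support
  · rw [← key ⟨a, hs ha⟩, h0]; simp
  · simpa using ha

/-- Coordinates in monomial bases are compatible with a change of the coefficient ring. -/
theorem repr_mk_map (b : Module.Basis B S (MvPolynomial σ S ⧸ J))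
    (hb : ∀ a, b a = Ideal.Quotient.mk J (monomial a.1 1))
    {J' : Ideal (MvPolynomial σ L)} (hJ' : J.map (map φ) ≤ J')
    (b' : Module.Basis B L (MvPolynomial σ L ⧸ J'))
    (hb' : ∀ a, b' a = Ideal.Quotient.mk J' (monomial a.1 1)) (p : MvPolynomial σ S) (a : B) :
    b'.repr (Ideal.Quotient.mk J' (map φ p)) a = φ (b.repr (Ideal.Quotient.mk J p) a) := by
  -- `q` is the normal form of `p` modulo `J`; its image is visibly a combination of the `b'` with
  -- coefficients in the image of `φ`.
  let q : MvPolynomial σ S :=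
    (b.repr (Ideal.Quotient.mk J p)).sum fun i c => monomial i.1 c
  have hq : Ideal.Quotient.mk J p = Ideal.Quotient.mk J q := by
    conv_lhs => rw [← b.linearCombination_repr (Ideal.Quotient.mk J p),
      Finsupp.linearCombination_apply]
    simp only [q, Finsupp.sum, map_sum, hb]
    refine Finset.sum_congr rfl fun i _ => ?_
    change Ideal.Quotient.mk J (_ • _) = _
    simp [smul_monomial]
  have hq' : Ideal.Quotient.mk J' (map φ p) = Ideal.Quotient.mk J' (map φ q) := by
    rw [Ideal.Quotient.eq, ← map_sub]
    exact hJ' (Ideal.mem_map_of_mem _ (Ideal.Quotient.eq.1 hq))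
  have hsum : Ideal.Quotient.mk J' (map φ q) =
      Finsupp.linearCombination L b'
        ((b.repr (Ideal.Quotient.mk J p)).mapRange φ φ.map_zero) := by
    rw [Finsupp.linearCombination_apply, Finsupp.sum_mapRange_index (fun i => by simp)]
    simp only [q, Finsupp.sum, map_sum, hb']
    refine Finset.sum_congr rfl fun i _ => ?_
    change _ = Ideal.Quotient.mk J' (_ • _)
    simp [smul_monomial]
  rw [hq', hsum, b'.repr_linearCombination, Finsupp.mapRange_apply]

end BaseChange

theorem trace_mulLeft_eq_sum {κ k A : Type*} [Fintype κ] [CommRing k] [CommRing A] [Algebra k A]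
    (b : Module.Basis κ k A) (u : A) :
    LinearMap.trace k A (LinearMap.mulLeft k u) = ∑ i, b.repr (u * b i) i := by
  classical
  rw [LinearMap.trace_eq_matrix_trace k b]
  simp [Matrix.trace, Algebra.leftMulMatrix_eq_repr_mul]

/-! ### Gröbner bases and block orders -/

theorem coeff_coeff_inX {n t : ℕ} (q : XY n t) (a : Fin n →₀ ℕ) (b : Fin t →₀ ℕ) :
    ((inX q).coeff a).coeff b =
      q.coeff (Finsupp.sumFinsuppAddEquivProdFinsupp.symm (a, b)) := by
  classical
  induction q using MvPolynomial.induction_on' with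
  | monomial d c =>
    obtain ⟨⟨a', b'⟩, rfl⟩ := Finsupp.sumFinsuppAddEquivProdFinsupp.symm.surjective d
    have : inX (monomial (Finsupp.sumFinsuppAddEquivProdFinsupp.symm (a', b')) c : XY n t) =
        monomial a' (monomial b' c) := by
      simp [inX, sumAlgEquiv, monomial]
    rw [this]
    simp only [coeff_monomial, EmbeddingLike.apply_eq_iff_eq, Prod.mk.injEq]
    split_ifs <;> simp_all
  | add p q hp hq =>
    have : inX (p + q) = inX p + inX q := map_add _ p q
    rw [this, coeff_add, coeff_add, hp, hq, coeff_add]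

theorem inX_eq_zero_iff {n t : ℕ} {q : XY n t} : inX q = 0 ↔ q = 0 :=
  map_eq_zero_iff _ (sumAlgEquiv ℚ (Fin n) (Fin t)).injective

/-- The leading monomial in `x` is the `x`-part of the leading monomial for the block order. -/
theorem degree_inX {n t : ℕ} (mx : MonomialOrder (Fin n)) (my : MonomialOrder (Fin t))
    (q : XY n t) :
    mx.degree (inX q) =
      (Finsupp.sumFinsuppAddEquivProdFinsupp ((blockOrder mx my).degree q)).1 := by
  by_cases hq : q = 0
  · subst hq
    have : inX (0 : XY n t) = 0 := map_zero _
    simp [this]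
  apply mx.toSyn.injective
  apply le_antisymm
  · have hx : inX q ≠ 0 := inX_eq_zero_iff.not.2 hq
    -- Any monomial of the leading coefficient in `x` yields a monomial of `q`, bounded by the block
    -- leading monomial; the order compares `x`-parts first.
    obtain ⟨b, hb⟩ := ne_zero_iff.1 (mx.coeff_degree_ne_zero_iff.2 hx)
    rw [coeff_coeff_inX] at hb
    have h := (blockOrder mx my).le_degree (mem_support_iff.2 hb)
    have h' := (Prod.Lex.le_iff (α := mx.syn) (β := my.syn)).1 h
    have hfst : ∀ d, (ofLex (show mx.syn ×ₗ my.syn from (blockOrder mx my).toSyn d)).1 =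
        mx.toSyn (Finsupp.sumFinsuppAddEquivProdFinsupp d).1 := fun _ => rfl
    have h'' := h'.elim le_of_lt fun h => h.1.le
    erw [hfst, hfst, AddEquiv.apply_symm_apply] at h''
    exact h''
  · apply mx.le_degree
    rw [mem_support_iff, ne_zero_iff]
    refine ⟨(Finsupp.sumFinsuppAddEquivProdFinsupp ((blockOrder mx my).degree q)).2, ?_⟩
    rw [coeff_coeff_inX, Prod.mk.eta, AddEquiv.symm_apply_apply]
    exact (blockOrder mx my).coeff_degree_ne_zero_iff.2 hq

theorem IsReducedGroebnerBasis.exists_degree_le {σ k : Type*} [Field k] {m : MonomialOrder σ}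
    {I : Ideal (MvPolynomial σ k)} {G : Set (MvPolynomial σ k)}
    (hG : IsReducedGroebnerBasis m I G) {p : MvPolynomial σ k} (hp : p ∈ I) (hp0 : p ≠ 0) :
    ∃ γ ∈ G, m.degree γ ≤ m.degree p := by
  have h1 : m.leadingTerm p ∈ Ideal.span (m.leadingTerm '' G) := by
    rw [hG.span_leadingTerm]
    exact Ideal.subset_span ⟨p, hp, rfl⟩
  have h2 : m.leadingTerm '' G = (fun s => monomial s 1) '' (m.degree '' G) := by
    rw [Set.image_image]
    refine Set.image_congr fun γ hγ => ?_
    rw [MonomialOrder.leadingTerm, (hG.monic γ hγ).leadingCoeff_eq_one]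
  rw [h2, mem_ideal_span_monomial_image, m.support_leadingTerm' hp0] at h1
  obtain ⟨_, ⟨γ, hγ, rfl⟩, h⟩ := h1 _ (Finset.mem_singleton_self _)
  exact ⟨γ, hγ, h⟩

/-- Divisibility of the block leading monomials restricts to their `x`-parts, which are the leading
monomials in `x`. -/
theorem IsReducedGroebnerBasis.exists_degree_inX_le {n t : ℕ} {mx : MonomialOrder (Fin n)}
    {my : MonomialOrder (Fin t)} {I : Ideal (XY n t)} {G : Set (XY n t)}
    (hG : IsReducedGroebnerBasis (blockOrder mx my) I G) {p : XY n t} (hp : p ∈ I)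
    (hp0 : p ≠ 0) : ∃ γ ∈ G, mx.degree (inX γ) ≤ mx.degree (inX p) := by
  obtain ⟨γ, hγ, h⟩ := hG.exists_degree_le hp hp0
  refine ⟨γ, hγ, ?_⟩
  rw [degree_inX mx my, degree_inX mx my]
  intro i
  exact h (Sum.inl i)

theorem isGroebnerBasis_of_exists_degree_le {σ k : Type*} [Field k] {m : MonomialOrder σ}
    {I : Ideal (MvPolynomial σ k)} {G : Set (MvPolynomial σ k)} (hfin : G.Finite) (hGI : G ⊆ I)
    (hG0 : ∀ γ ∈ G, IsUnit (m.leadingCoeff γ))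
    (h : ∀ p ∈ I, p ≠ 0 → ∃ γ ∈ G, m.degree γ ≤ m.degree p) : IsGroebnerBasis m I G := by
  refine ⟨hfin, hGI, le_antisymm (Ideal.span_mono (Set.image_mono hGI)) ?_⟩
  rw [Ideal.span_le]
  rintro _ ⟨p, hp, rfl⟩
  by_cases hp0 : p = 0
  · subst hp0; simp
  obtain ⟨γ, hγ, hle⟩ := h p hp hp0
  obtain ⟨u, hu⟩ := hG0 γ hγ
  have : m.leadingTerm p =
      monomial (m.degree p - m.degree γ) (m.leadingCoeff p * ↑u⁻¹) * m.leadingTerm γ := by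
    rw [MonomialOrder.leadingTerm, MonomialOrder.leadingTerm, monomial_mul,
      tsub_add_cancel_of_le hle, ← hu, mul_assoc, Units.inv_mul, mul_one]
  rw [this]
  exact Ideal.mul_mem_left _ _ (Ideal.subset_span ⟨γ, hγ, rfl⟩)

theorem degree_map_of_ne_zero {σ R S : Type*} [CommSemiring R] [CommSemiring S]
    (m : MonomialOrder σ) (φ : R →+* S) {p : MvPolynomial σ R}
    (h : φ (m.leadingCoeff p) ≠ 0) : m.degree (map φ p) = m.degree p := by
  apply m.toSyn.injective
  apply le_antisymm
  · rw [m.degree_le_iff]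
    exact fun a ha => m.le_degree (support_map_subset φ p ha)
  · apply m.le_degree
    rw [mem_support_iff, coeff_map]
    exact h

theorem leadingCoeff_map_of_ne_zero {σ R S : Type*} [CommSemiring R] [CommSemiring S]
    (m : MonomialOrder σ) (φ : R →+* S) {p : MvPolynomial σ R}
    (h : φ (m.leadingCoeff p) ≠ 0) : m.leadingCoeff (map φ p) = φ (m.leadingCoeff p) := by
  rw [MonomialOrder.leadingCoeff, degree_map_of_ne_zero m φ h, coeff_map]
  rfl

/-- Clearing denominators in an extended ideal. -/
theorem exists_mul_C_eq_map {σ R S : Type*} [CommRing R] [CommRing S] [Algebra R S]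
    (M : Submonoid R) [IsLocalization M S] {I : Ideal (MvPolynomial σ R)} {p : MvPolynomial σ S}
    (hp : p ∈ I.map (map (algebraMap R S))) :
    ∃ s ∈ M, ∃ q ∈ I, p * C (algebraMap R S s) = map (algebraMap R S) q := by
  let _ : Algebra (MvPolynomial σ R) (MvPolynomial σ S) := algebraMvPolynomial
  rw [← algebraMap_def] at hp
  -- The polynomial ring over `S` is the localization of the one over `R` at the constants from `M`.
  obtain ⟨⟨q, ⟨_, s, hs, rfl⟩⟩, h⟩ :=
    (IsLocalization.mem_map_algebraMap_iff (M.map (C (σ := σ))) (MvPolynomial σ S)).1 hp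
  refine ⟨s, hs, q.1, q.2, ?_⟩
  simpa only [algebraMap_def, map_C] using h

/-! ### Specialization of the quotient algebra -/

/-- The polynomials in `y` which do not vanish at the given point. -/
def nonvanishing {t : ℕ} (y : Fin t → ℂ) : Submonoid (MvPolynomial (Fin t) ℚ) where
  carrier := {b | aeval y b ≠ 0}
  one_mem' := by simp
  mul_mem' := fun ha hb => by simpa using ⟨ha, hb⟩

theorem nonvanishing_le {t : ℕ} (y : Fin t → ℂ) :
    nonvanishing y ≤ nonZeroDivisors (MvPolynomial (Fin t) ℚ) := by
  intro b hb
  rw [mem_nonZeroDivisors_iff_ne_zero]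
  rintro rfl
  exact hb (map_zero _)

/-- The ring of rational functions defined at `y`. -/
def LocalFun {t : ℕ} (y : Fin t → ℂ) : Type := Localization (nonvanishing y)

noncomputable instance {t : ℕ} (y : Fin t → ℂ) : CommRing (LocalFun y) :=
  inferInstanceAs (CommRing (Localization (nonvanishing y)))

noncomputable instance {t : ℕ} (y : Fin t → ℂ) : Algebra (MvPolynomial (Fin t) ℚ) (LocalFun y) :=
  inferInstanceAs (Algebra _ (Localization (nonvanishing y)))

instance {t : ℕ} (y : Fin t → ℂ) : IsLocalization (nonvanishing y) (LocalFun y) :=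
  inferInstanceAs (IsLocalization _ (Localization (nonvanishing y)))

instance {t : ℕ} (y : Fin t → ℂ) : Nontrivial (LocalFun y) :=
  (IsLocalization.injective (LocalFun y) (nonvanishing_le y)).nontrivial

/-- A function defined at `y` seen as a rational function. -/
noncomputable def LocalFun.toRatFun {t : ℕ} (y : Fin t → ℂ) : LocalFun y →+* RatFun t :=
  IsLocalization.lift (M := nonvanishing y)
    (g := algebraMap (MvPolynomial (Fin t) ℚ) (RatFun t)) fun b =>
    IsLocalization.map_units (RatFun t) (⟨b.1, nonvanishing_le y b.2⟩ : nonZeroDivisors _)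

/-- The value at `y` of a function defined at `y`. -/
noncomputable def LocalFun.eval {t : ℕ} (y : Fin t → ℂ) : LocalFun y →+* ℂ :=
  IsLocalization.lift (M := nonvanishing y)
    (g := (aeval y : MvPolynomial (Fin t) ℚ →ₐ[ℚ] ℂ).toRingHom) fun b =>
    isUnit_iff_ne_zero.2 b.2

theorem LocalFun.toRatFun_comp {t : ℕ} (y : Fin t → ℂ) :
    (LocalFun.toRatFun y).comp (algebraMap _ (LocalFun y)) =
      algebraMap (MvPolynomial (Fin t) ℚ) (RatFun t) :=
  IsLocalization.lift_comp _

theorem LocalFun.eval_comp {t : ℕ} (y : Fin t → ℂ) :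
    (LocalFun.eval y).comp (algebraMap _ (LocalFun y)) =
      (aeval y : MvPolynomial (Fin t) ℚ →ₐ[ℚ] ℂ).toRingHom :=
  IsLocalization.lift_comp _

theorem LocalFun.hasValueAt {t : ℕ} (y : Fin t → ℂ) (s : LocalFun y) :
    HasValueAt y (LocalFun.toRatFun y s) (LocalFun.eval y s) := by
  obtain ⟨⟨a, b⟩, hs⟩ := IsLocalization.surj (nonvanishing y) s
  have hb : algebraMap _ (RatFun t) b.1 ≠ 0 :=
    IsFractionRing.to_map_ne_zero_of_mem_nonZeroDivisors (nonvanishing_le y b.2)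
  refine ⟨a, b, b.2, ?_, ?_⟩
  · rw [eq_div_iff hb, ← LocalFun.toRatFun_comp y]
    simpa using congrArg (LocalFun.toRatFun y) hs
  · rw [eq_div_iff b.2]
    have := congrArg (LocalFun.eval y) hs
    rwa [map_mul, ← RingHom.comp_apply, ← RingHom.comp_apply, LocalFun.eval_comp] at this

theorem LocalFun.exists_of_hasValueAt {t : ℕ} {y : Fin t → ℂ} {h : RatFun t} {v : ℂ}
    (hv : HasValueAt y h v) :
    ∃ s : LocalFun y, LocalFun.toRatFun y s = h ∧ LocalFun.eval y s = v := by
  obtain ⟨a, b, hb, rfl, rfl⟩ := hv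
  have hb' : algebraMap _ (RatFun t) b ≠ 0 :=
    IsFractionRing.to_map_ne_zero_of_mem_nonZeroDivisors (nonvanishing_le y hb)
  refine ⟨IsLocalization.mk' _ a (⟨b, hb⟩ : nonvanishing y), ?_, ?_⟩
  · rw [LocalFun.toRatFun, IsLocalization.lift_mk'_spec, mul_div_cancel₀ _ hb']
  · rw [LocalFun.eval, IsLocalization.lift_mk'_spec]
    exact (mul_div_cancel₀ _ hb).symm

/-- Reduces statements about polynomials with coefficients defined at `y` to polynomials over the
local ring. -/
theorem exists_of_hasSpecialization {n t : ℕ} {y : Fin t → ℂ}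
    {q : MvPolynomial (Fin n) (RatFun t)} {Q : MvPolynomial (Fin n) ℂ}
    (h : HasSpecialization y q Q) :
    ∃ s : MvPolynomial (Fin n) (LocalFun y),
      map (LocalFun.toRatFun y) s = q ∧ map (LocalFun.eval y) s = Q := by
  classical
  choose c hc using fun a => LocalFun.exists_of_hasValueAt (h a)
  -- Summing over the union of both supports lets one lift serve both maps; the extra terms map to
  -- zero.
  have key : ∀ {L : Type} [CommRing L] (φ : LocalFun y →+* L) (p : MvPolynomial (Fin n) L),
      p.support ⊆ q.support ∪ Q.support → (∀ a, φ (c a) = p.coeff a) →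
      map φ (∑ a ∈ q.support ∪ Q.support, monomial a (c a)) = p := by
    intro L _ φ p hp hφ
    simp only [map_sum, map_monomial, hφ]
    rw [← Finset.sum_subset hp, ← p.as_sum]
    intro a _ ha
    rw [notMem_support_iff.1 ha, monomial_zero]
  exact ⟨_, key _ q Finset.subset_union_left fun a => (hc a).1,
    key _ Q Finset.subset_union_right fun a => (hc a).2⟩

/-! ### Freeness over the local ring and its specializations -/

section Main

variable {n t r : ℕ} {mx : MonomialOrder (Fin n)} {my : MonomialOrder (Fin t)}
  {f : Fin r → XY n t} {G : Set (XY n t)} {y : Fin t → ℂ}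

/-- A polynomial of `ℚ[x, y]` seen as a polynomial in `x` over the functions defined at `y`. -/
noncomputable def localX (y : Fin t → ℂ) : XY n t →+* MvPolynomial (Fin n) (LocalFun y) :=
  (map (algebraMap (MvPolynomial (Fin t) ℚ) (LocalFun y))).comp
    (sumAlgEquiv ℚ (Fin n) (Fin t)).toRingEquiv.toRingHom

theorem localX_apply (q : XY n t) :
    localX y q = map (algebraMap (MvPolynomial (Fin t) ℚ) (LocalFun y)) (inX q) := rfl

theorem map_toRatFun_localX (q : XY n t) :
    map (LocalFun.toRatFun y) (localX y q) = generic q := by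
  rw [localX_apply, map_map, LocalFun.toRatFun_comp]; rfl

theorem map_eval_localX (q : XY n t) : map (LocalFun.eval y) (localX y q) = specialize y q := by
  rw [localX_apply, map_map, LocalFun.eval_comp]; rfl

theorem map_localX_span (f : Fin r → XY n t) {L : Type*} [CommRing L] (φ : LocalFun y →+* L)
    {F : Fin r → MvPolynomial (Fin n) L} (hF : ∀ i, map φ (localX y (f i)) = F i) :
    ((Ideal.span (Set.range f)).map (localX y)).map (map φ) = Ideal.span (Set.range F) := by
  rw [Ideal.map_map, Ideal.map_span, ← Set.range_comp]
  congr 2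
  funext i
  exact hF i

theorem isUnit_leadingCoeff_localX (hy : y ∉ badLocus mx G) {γ : XY n t} (hγ : γ ∈ G) :
    IsUnit (algebraMap _ (LocalFun y) (mx.leadingCoeff (inX γ))) := by
  refine IsLocalization.map_units (LocalFun y)
    (⟨mx.leadingCoeff (inX γ), fun h => hy ?_⟩ : nonvanishing y)
  exact Set.mem_biUnion hγ h

theorem degree_map_localX (hy : y ∉ badLocus mx G) {γ : XY n t} (hγ : γ ∈ G) {L : Type*}
    [CommRing L] [Nontrivial L] (φ : LocalFun y →+* L) :
    mx.degree (map φ (localX y γ)) = mx.degree (inX γ) := by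
  rw [localX_apply, map_map]
  exact degree_map_of_ne_zero _ _ ((isUnit_leadingCoeff_localX hy hγ).map φ).ne_zero

theorem isUnit_leadingCoeff_map_localX (hy : y ∉ badLocus mx G) {γ : XY n t} (hγ : γ ∈ G)
    {L : Type*} [CommRing L] [Nontrivial L] (φ : LocalFun y →+* L) :
    IsUnit (mx.leadingCoeff (map φ (localX y γ))) := by
  have h := (isUnit_leadingCoeff_localX hy hγ).map φ
  rw [localX_apply, map_map, leadingCoeff_map_of_ne_zero]
  · exact h
  · exact h.ne_zero

theorem irreducibleExponents_eq (hy : y ∉ badLocus mx G) {L : Type*} [CommRing L] [Nontrivial L]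
    (φ : LocalFun y →+* L) :
    irreducibleExponents mx G =
      {a | ∀ γ ∈ (fun γ => map φ (localX y γ)) '' G, ¬ mx.degree γ ≤ a} := by
  ext a
  simp only [irreducibleExponents, Set.mem_ofPred_eq, Set.forall_mem_image]
  exact forall₂_congr fun γ hγ => by rw [degree_map_localX hy hγ]

/-- This is the independence of the irreducible monomials, and the place where the elimination
property of the order enters. -/
theorem localX_eq_zero_of_support_subset {I : Ideal (XY n t)}
    (hG : IsReducedGroebnerBasis (blockOrder mx my) I G)
    {p : MvPolynomial (Fin n) (LocalFun y)} (hp : p ∈ I.map (localX y))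
    (hs : ↑p.support ⊆ irreducibleExponents mx G) : p = 0 := by
  have hinj := IsLocalization.injective (LocalFun y) (nonvanishing_le y)
  rw [localX, ← Ideal.map_map] at hp
  obtain ⟨s, hs', q, hq, h⟩ := exists_mul_C_eq_map (nonvanishing y) hp
  obtain ⟨q, hqI, rfl⟩ :=
    (Ideal.mem_map_of_equiv (sumAlgEquiv ℚ (Fin n) (Fin t)).toRingEquiv q).1 hq
  change _ = map _ (inX q) at h
  have hu : IsUnit (algebraMap _ (LocalFun y) s) :=
    IsLocalization.map_units (LocalFun y) (⟨s, hs'⟩ : nonvanishing y)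
  by_contra hp0
  have hq0 : q ≠ 0 := by
    rintro rfl
    have : inX (0 : XY n t) = 0 := map_zero _
    rw [this, map_zero] at h
    exact hp0 ((hu.map C).mul_left_eq_zero.1 h)
  obtain ⟨γ, hγ, hle⟩ := hG.exists_degree_inX_le hqI hq0
  -- The coefficients of `q` are those of `p` times `s`, so the leading monomial of `q` in `x`
  -- occurs in `p`, although it is reducible by `γ`.
  refine hs (?_ : mx.degree (inX q) ∈ p.support) γ hγ hle
  have h1 := congrArg (coeff (mx.degree (inX q))) h
  rw [mul_comm, coeff_C_mul, coeff_map] at h1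
  rw [mem_support_iff]
  intro h2
  rw [h2, mul_zero] at h1
  exact mx.coeff_degree_ne_zero_iff.2 (inX_eq_zero_iff.not.2 hq0)
    (hinj (h1.symm.trans (map_zero _).symm))

/-- The irreducible monomials are a basis over the ring of functions defined at `y`. -/
theorem exists_basis_localX {I : Ideal (XY n t)}
    (hG : IsReducedGroebnerBasis (blockOrder mx my) I G) (hy : y ∉ badLocus mx G) :
    ∃ b : Module.Basis (irreducibleExponents mx G) (LocalFun y)
        (MvPolynomial (Fin n) (LocalFun y) ⧸ I.map (localX y)),
      ∀ a, b a = Ideal.Quotient.mk (I.map (localX y)) (monomial a.1 1) := by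
  refine exists_basis_of_isUnit_leadingCoeff (m := mx)
    -- The identity as change of coefficients makes the lemmas on images of `G` applicable over the
    -- local ring itself.
    (G := (fun γ => map (RingHom.id _) (localX y γ)) '' G) ?_ ?_
    (irreducibleExponents_eq hy _) fun p hp hs => localX_eq_zero_of_support_subset hG hp hs
  · rintro _ ⟨γ, hγ, rfl⟩
    exact isUnit_leadingCoeff_map_localX hy hγ _
  · rintro _ ⟨γ, hγ, rfl⟩
    simpa only [map_id] using! Ideal.mem_map_of_mem (localX y) (hG.subset hγ)

theorem eq_zero_of_support_subset {I : Ideal (XY n t)}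
    (hG : IsReducedGroebnerBasis (blockOrder mx my) I G) (hy : y ∉ badLocus mx G)
    {L : Type*} [CommRing L] (φ : LocalFun y →+* L) {p : MvPolynomial (Fin n) L}
    (hp : p ∈ (I.map (localX y)).map (map φ)) (hs : ↑p.support ⊆ irreducibleExponents mx G) :
    p = 0 := by
  obtain ⟨b, hb⟩ := exists_basis_localX hG hy
  exact eq_zero_of_mem_map_of_support_subset φ b hb hp hs

/-- The irreducible monomials stay a basis after any change of coefficients. -/
theorem exists_basis_map_localX {I : Ideal (XY n t)}
    (hG : IsReducedGroebnerBasis (blockOrder mx my) I G) (hy : y ∉ badLocus mx G)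
    {L : Type*} [CommRing L] [Nontrivial L] (φ : LocalFun y →+* L)
    {J : Ideal (MvPolynomial (Fin n) L)} (hJ : (I.map (localX y)).map (map φ) = J) :
    ∃ b : Module.Basis (irreducibleExponents mx G) L (MvPolynomial (Fin n) L ⧸ J),
      ∀ a, b a = Ideal.Quotient.mk J (monomial a.1 1) := by
  subst hJ
  refine exists_basis_of_isUnit_leadingCoeff (m := mx)
    (G := (fun γ => map φ (localX y γ)) '' G) ?_ ?_
    (irreducibleExponents_eq hy _) fun p hp hs => eq_zero_of_support_subset hG hy φ hp hs
  · rintro _ ⟨γ, hγ, rfl⟩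
    exact isUnit_leadingCoeff_map_localX hy hγ _
  · rintro _ ⟨γ, hγ, rfl⟩
    exact Ideal.mem_map_of_mem _ (Ideal.mem_map_of_mem _ (hG.subset hγ))

/-- With unit leading coefficients, dividing an element of the ideal by the specialized `G` leaves a
remainder in the ideal supported on irreducible monomials, hence zero; its leading monomial is
therefore reducible. -/
theorem isGroebnerBasis_specialize {I : Ideal (XY n t)}
    (hG : IsReducedGroebnerBasis (blockOrder mx my) I G) (hy : y ∉ badLocus mx G)
    {J : Ideal (MvPolynomial (Fin n) ℂ)}
    (hJ : (I.map (localX y)).map (map (LocalFun.eval y)) = J) :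
    IsGroebnerBasis mx J (specialize y '' G) := by
  subst hJ
  have himg : specialize y '' G = (fun γ => map (LocalFun.eval y) (localX y γ)) '' G :=
    Set.image_congr fun γ _ => (map_eval_localX γ).symm
  rw [himg]
  have hunit : ∀ γ ∈ (fun γ => map (LocalFun.eval y) (localX y γ)) '' G,
      IsUnit (mx.leadingCoeff γ) := by
    rintro _ ⟨γ, hγ, rfl⟩
    exact isUnit_leadingCoeff_map_localX hy hγ _
  have hsub : (fun γ => map (LocalFun.eval y) (localX y γ)) '' G ⊆
      ((I.map (localX y)).map (map (LocalFun.eval y)) : Set (MvPolynomial (Fin n) ℂ)) := by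
    rintro _ ⟨γ, hγ, rfl⟩
    exact Ideal.mem_map_of_mem _ (Ideal.mem_map_of_mem _ (hG.subset hγ))
  refine isGroebnerBasis_of_exists_degree_le (hG.finite.image _) hsub hunit fun p hp hp0 =>
    exists_degree_le_of_isUnit_leadingCoeff hunit hsub (fun q hq hs => ?_) hp hp0
  rw [← irreducibleExponents_eq hy] at hs
  exact eq_zero_of_support_subset hG hy _ hq hs

end Main

/-! ### Hermite's forms under change of coefficients -/

/-- Hermite's bilinear form in a monomial basis is compatible with a change of coefficients. -/
theorem hermiteBilin_map {σ ι S k : Type*} [CommRing S] [Field k] (φ : S →+* k)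
    {J : Ideal (MvPolynomial σ S)} {B : Set (σ →₀ ℕ)} [Fintype B]
    (b : Module.Basis B S (MvPolynomial σ S ⧸ J))
    (hb : ∀ a, b a = Ideal.Quotient.mk J (monomial a.1 1))
    {F : ι → MvPolynomial σ k} (hF : J.map (map φ) = Ideal.span (Set.range F))
    (b' : Module.Basis B k (QuotAlg F)) (hb' : ∀ a, b' a = cls F (monomial a.1 1))
    (g p q : MvPolynomial σ S) :
    hermiteBilin F (map φ g) (cls F (map φ p)) (cls F (map φ q)) =
      φ (∑ a : B, b.repr (Ideal.Quotient.mk J (g * p * q * monomial a.1 1)) a) := by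
  change LinearMap.trace k _ (LinearMap.mulLeft k (_ * _ * _)) = _
  -- The trace is the sum of diagonal coordinates, each the image of a coordinate over `S`.
  rw [trace_mulLeft_eq_sum b', map_sum]
  refine Finset.sum_congr rfl fun a _ => ?_
  rw [← repr_mk_map φ b hb hF.le b' hb', hb']
  simp only [cls, map_mul, map_monomial, map_one]

/-- A finitely generated algebra over a field is finite-dimensional exactly when its Krull dimension
is at most zero; the zero ring is included. -/
theorem finite_quotAlg {n : ℕ} {ι k : Type*} [Field k] {f : ι → MvPolynomial (Fin n) k}
    (hf : IsZeroDimensional f) : Module.Finite k (QuotAlg f) := by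
  have : Ring.KrullDimLE 0 (QuotAlg f) := Ring.krullDimLE_iff.2 hf
  exact (Module.finite_iff_krullDimLE_zero k (QuotAlg f)).2 this

end HermiteSpec

open HermiteSpec in
theorem mainTheorem5 {n t r : ℕ}
    (mx : MonomialOrder (Fin n)) (my : MonomialOrder (Fin t))
    (f : Fin r → HermiteSpec.XY n t)
    (hf : HermiteSpec.IsZeroDimensional (fun i => HermiteSpec.generic (f i)))
    (G : Set (HermiteSpec.XY n t))
    (hG : HermiteSpec.IsReducedGroebnerBasis (HermiteSpec.blockOrder mx my)
      (Ideal.span (Set.range f)) G)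
    (y : Fin t → ℂ) (hy : y ∉ HermiteSpec.badLocus mx G) :
    -- `G(y, ·)` is a Gröbner basis of `⟨f(y, ·)⟩`
    HermiteSpec.IsGroebnerBasis mx
      (Ideal.span (Set.range fun i => HermiteSpec.specialize y (f i)))
      (HermiteSpec.specialize y '' G) ∧
    -- the monomials irreducible by `G` are a finite basis of both quotient algebras
    (HermiteSpec.irreducibleExponents mx G).Finite ∧
    ∃ (bK : Module.Basis (HermiteSpec.irreducibleExponents mx G) (HermiteSpec.RatFun t)
          (HermiteSpec.QuotAlg fun i => HermiteSpec.generic (f i)))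
      (bC : Module.Basis (HermiteSpec.irreducibleExponents mx G) ℂ
          (HermiteSpec.QuotAlg fun i => HermiteSpec.specialize y (f i))),
      (∀ a, bK a = HermiteSpec.cls _ (monomial a.1 1)) ∧
      (∀ a, bC a = HermiteSpec.cls _ (monomial a.1 1)) ∧
      -- for every `g` in `ℚ(y)[x]` whose coefficients are defined at `y`, with `g(y, ·) = gy`
      ∀ (g : MvPolynomial (Fin n) (HermiteSpec.RatFun t)) (gy : MvPolynomial (Fin n) ℂ),
        HermiteSpec.HasSpecialization y g gy →
        -- the parametric Hermite matrix specializes to the Hermite matrix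
        (∀ a b, HermiteSpec.HasValueAt y
          (HermiteSpec.hermiteMatrix (fun i => HermiteSpec.generic (f i)) g bK a b)
          (HermiteSpec.hermiteMatrix (fun i => HermiteSpec.specialize y (f i)) gy bC a b)) ∧
        -- the parametric Hermite quadratic form specializes to the Hermite quadratic form
        (∀ (q : MvPolynomial (Fin n) (HermiteSpec.RatFun t)) (qy : MvPolynomial (Fin n) ℂ),
          HermiteSpec.HasSpecialization y q qy →
          HermiteSpec.HasValueAt y
            (HermiteSpec.hermiteForm (fun i => HermiteSpec.generic (f i)) g
              (HermiteSpec.cls _ q))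
            (HermiteSpec.hermiteForm (fun i => HermiteSpec.specialize y (f i)) gy
              (HermiteSpec.cls _ qy))) := by
  have hK := map_localX_span f (LocalFun.toRatFun y) fun i => map_toRatFun_localX (f i)
  have hC := map_localX_span f (LocalFun.eval y) fun i => map_eval_localX (f i)
  obtain ⟨bS, hS⟩ := exists_basis_localX hG hy
  obtain ⟨bK, hbK⟩ := exists_basis_map_localX hG hy (LocalFun.toRatFun y) hK
  obtain ⟨bC, hbC⟩ := exists_basis_map_localX hG hy (LocalFun.eval y) hC
  have := finite_quotAlg hf
  -- Zero-dimensionality is only assumed generically; finiteness passes to the fibre at `y` because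
  -- both bases have the same index set.
  have hfin : Finite (irreducibleExponents mx G) := Module.Finite.finite_basis bK
  have := Fintype.ofFinite (irreducibleExponents mx G)
  have key : ∀ g p q : MvPolynomial (Fin n) (LocalFun y), HasValueAt y
      (hermiteBilin (fun i => generic (f i)) (map (LocalFun.toRatFun y) g)
        (cls _ (map (LocalFun.toRatFun y) p)) (cls _ (map (LocalFun.toRatFun y) q)))
      (hermiteBilin (fun i => specialize y (f i)) (map (LocalFun.eval y) g)
        (cls _ (map (LocalFun.eval y) p)) (cls _ (map (LocalFun.eval y) q))) := by
    intro g p q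
    -- Both sides become images of the same element of the local ring.
    rw [hermiteBilin_map _ bS hS hK bK hbK, hermiteBilin_map _ bS hS hC bC hbC]
    exact LocalFun.hasValueAt y _
  refine ⟨isGroebnerBasis_specialize hG hy hC, hfin, bK, bC, hbK, hbC, fun g gy hg => ?_⟩
  obtain ⟨g, rfl, rfl⟩ := exists_of_hasSpecialization hg
  refine ⟨fun a b => ?_, fun q qy hq => ?_⟩
  · have h := key g (monomial a.1 1) (monomial b.1 1)
    simp only [map_monomial, map_one] at h
    simpa only [hermiteMatrix, Matrix.of_apply, hbK, hbC] using h
  · obtain ⟨q, rfl, rfl⟩ := exists_of_hasSpecialization hq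
    exact key g q q
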